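/- **Theorem (Basic properties of the Kuramoto map).** Let $G$ be a connected undirected weighted simple graph with nodes $\{1,\dots,n\}$, $m$ edges and symmetric weights $a_{ij}$, where $a_{ij}>0$ if $\{i,j\}$ is an edge and $a_{ij}=0$ otherwise. Choose any enumeration and orientation of the edges. Let $B\in\mathbb{R}^{n\times m}$ be the oriented incidence matrix, $\mathcal{A}\in\mathbb{R}^{m\times m}$ the diagonal matrix of edge weights, $L=\mathrm{diag}\big(\sum_j a_{ij}\big)_i-(a_{ij})$ the Laplacian, $L^\dagger$ its Moore–Penrose pseudoinverse, and $\mathcal{P}$ the oblique projection of $\mathbb{R}^m$ onto $\mathrm{Img}(B^\top)$ parallel to $\mathrm{Ker}(B\mathcal{A})$. Let $\mathbf{1}_n^\perp=\{x\in\mathbb{R}^n:\sum_i x_i=0\}$ and $\omega\in\mathbf{1}_n^\perp$, and consider the Kuramoto model $$\dot\theta=\omega-B\mathcal{A}\sin(B^\top\theta),\qquad \theta\in\mathbb{T}^n ,$$ with $\sin$ applied entrywise. Its state space is the quotient $\mathbb{T}^n/\mathrm{rot}$ of the torus by simultaneous rotations $\theta\mapsto(\theta_1+s,\dots,\theta_n+s)$;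 $[\theta]$ denotes the class of $\theta$. A class $[\theta^*]$ is a *synchronization manifold* if $\omega=B\mathcal{A}\sin(B^\top\theta^*)$. It is *locally exponentially stable* if there are $\delta,c,r>0$ such that every solution $\theta:[0,\infty)\to\mathbb{T}^n$ with $d([\theta(0)],[\theta^*])<\delta$ satisfies $d([\theta(t)],[\theta^*])\le c\,e^{-rt}\,d([\theta(0)],[\theta^*])$ for all $t\ge 0$, where $d$ is the quotient metric on $\mathbb{T}^n/\mathrm{rot}$ induced by the maximum of the componentwise geodesic distances on $\mathbb{T}^n$. The *Kuramoto map* is $$f_K:\mathbf{1}_n^\perp\to\mathrm{Img}(B^\top),\qquad f_K(x)=\mathcal{P}\sin(B^\top x).$$ For $\gamma\in[0,\pi/2)$ let $B^G(\gamma)=\{x\in\mathbf{1}_n^\perp:\|B^\top x\|_\infty\le\gamma\}$ and $S^G(\gamma)=\{[\exp(\mathrm{i}x)]:x\in B^G(\gamma)\}\subseteq\mathbb{T}^n/\mathrm{rot}$; a vector $x\in\mathbf{1}_n^\perp$ is said to be a synchronization manifold if $[\exp(\mathrm{i}x)]$ is one, and $S^G(\gamma)$ is identified with $B^G(\gamma)$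 through $x\mapsto[\exp(\mathrm{i}x)]$. Then, for every $\gamma\in[0,\pi/2)$: 1. for every $x^*\in\mathbf{1}_n^\perp$, the following are equivalent: $x^*$ is a synchronization manifold; $x^*$ solves the nodal balance equation $\omega=B\mathcal{A}\sin(B^\top x^*)$; $x^*$ solves the edge balance equation $B^\top L^\dagger\omega=\mathcal{P}\sin(B^\top x^*)=f_K(x^*)$; 2. $f_K$ is real analytic (on all of $\mathbf{1}_n^\perp$), and it is one-to-one on $S^G(\gamma)$, that is, on $B^G(\gamma)$; 3. if there is a synchronization manifold $x^*\in S^G(\gamma)$, then it is the only one in $S^G(\gamma)$ (both as a class in $\mathbb{T}^n/\mathrm{rot}$ and as a vector in $B^G(\gamma)$), and it is locally exponentially stable. -/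

import Mathlib

open scoped Matrix

noncomputable section

namespace Kuramoto

/-! ### The Moore-Penrose pseudoinverse of a real matrix -/

/-- The four Moore-Penrose identities: `X` is a Moore-Penrose pseudoinverse of `A`. -/
structure IsMoorePenrose {n m : ℕ} (A : Matrix (Fin n) (Fin m) ℝ)
    (X : Matrix (Fin m) (Fin n) ℝ) : Prop where
  mul_mul_self : A * X * A = A
  self_mul_mul : X * A * X = X
  transpose_mul : (A * X)ᵀ = A * X
  transpose_mul' : (X * A)ᵀ = X * A

/-- A Hermitian real matrix has a symmetric commuting Moore-Penrose pseudoinverse. -/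
theorem exists_moorePenrose_of_isHermitian {m : ℕ} {H : Matrix (Fin m) (Fin m) ℝ}
    (hH : H.IsHermitian) :
    ∃ K : Matrix (Fin m) (Fin m) ℝ,
      H * K * H = H ∧ K * H * K = K ∧ Kᵀ = K ∧ H * K = K * H := by
  obtain ⟨U, V, d, hVU, hUV, hH'⟩ : ∃ (U V : Matrix (Fin m) (Fin m) ℝ) (d : Fin m → ℝ),
      V * U = 1 ∧ V = Uᵀ ∧ H = U * Matrix.diagonal d * V := by
    refine ⟨hH.eigenvectorUnitary, star (hH.eigenvectorUnitary : Matrix (Fin m) (Fin m) ℝ),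
      hH.eigenvalues, ?_, ?_, ?_⟩
    · exact Unitary.coe_star_mul_self hH.eigenvectorUnitary
    · simp [Matrix.star_eq_conjTranspose]
    · have := hH.spectral_theorem
      rw [Unitary.conjStarAlgAut_apply] at this
      exact this
  have key : ∀ a b : Fin m → ℝ, (U * Matrix.diagonal a * V) * (U * Matrix.diagonal b * V)
      = U * Matrix.diagonal (fun i => a i * b i) * V := by
    intro a b
    calc (U * Matrix.diagonal a * V) * (U * Matrix.diagonal b * V)
        = U * Matrix.diagonal a * (V * U) * Matrix.diagonal b * V := by
          simp only [Matrix.mul_assoc]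
      _ = _ := by
          rw [hVU, Matrix.mul_one, Matrix.mul_assoc U, Matrix.diagonal_mul_diagonal]
  refine ⟨U * Matrix.diagonal (fun i => (d i)⁻¹) * V, ?_, ?_, ?_, ?_⟩
  · rw [hH', key, key]
    congr 3
    funext i
    exact mul_inv_mul_cancel (d i)
  · rw [hH', key, key]
    congr 3
    funext i
    simpa using mul_inv_mul_cancel (d i)⁻¹
  · rw [hUV]
    simp [Matrix.transpose_mul, Matrix.mul_assoc]
  · rw [hH', key, key]
    congr 3
    funext i
    exact mul_comm _ _

/-- Every real matrix has a Moore-Penrose pseudoinverse. -/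
theorem exists_isMoorePenrose {n m : ℕ} (A : Matrix (Fin n) (Fin m) ℝ) :
    ∃ X : Matrix (Fin m) (Fin n) ℝ, IsMoorePenrose A X := by
  have hH : (Aᵀ * A).IsHermitian := by
    simp [Matrix.IsHermitian, Matrix.conjTranspose_eq_transpose_of_trivial]
  obtain ⟨K, h1, h2, h3, h4⟩ := exists_moorePenrose_of_isHermitian hH
  have hA : A * K * (Aᵀ * A) = A := by
    have hz : (A * K * (Aᵀ * A) - A)ᵀ * (A * K * (Aᵀ * A) - A) = 0 := by
      have e : (A * K * (Aᵀ * A) - A)ᵀ = (Aᵀ * A) * K * Aᵀ - Aᵀ := by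
        simp [Matrix.transpose_mul, h3, Matrix.mul_assoc]
      have e2 : Aᵀ * (A * K * (Aᵀ * A) - A) = 0 := by
        rw [Matrix.mul_sub, sub_eq_zero]
        calc Aᵀ * (A * K * (Aᵀ * A)) = (Aᵀ * A) * K * (Aᵀ * A) := by
              simp only [Matrix.mul_assoc]
          _ = _ := h1
      rw [e, Matrix.sub_mul, Matrix.mul_assoc ((Aᵀ * A) * K), e2]
      simp
    have hz' : A * K * (Aᵀ * A) - A = 0 := by
      rw [← Matrix.conjTranspose_eq_transpose_of_trivial] at hz
      exact Matrix.conjTranspose_mul_self_eq_zero.mp hz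
    exact sub_eq_zero.mp hz'
  refine ⟨K * Aᵀ, ?_, ?_, ?_, ?_⟩
  · calc A * (K * Aᵀ) * A = A * K * (Aᵀ * A) := by simp only [Matrix.mul_assoc]
      _ = A := hA
  · calc K * Aᵀ * A * (K * Aᵀ) = K * (Aᵀ * A) * K * Aᵀ := by simp only [Matrix.mul_assoc]
      _ = K * Aᵀ := by rw [h2]
  · simp [Matrix.transpose_mul, h3, Matrix.mul_assoc]
  · have : K * Aᵀ * A = K * (Aᵀ * A) := Matrix.mul_assoc _ _ _
    rw [this, Matrix.transpose_mul, h3, Matrix.transpose_mul, Matrix.transpose_transpose, h4]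

/-- The Moore-Penrose pseudoinverse is unique. -/
theorem IsMoorePenrose.unique {n m : ℕ} {A : Matrix (Fin n) (Fin m) ℝ}
    {X Y : Matrix (Fin m) (Fin n) ℝ} (hX : IsMoorePenrose A X) (hY : IsMoorePenrose A Y) :
    X = Y := by
  have h1 : A * X = A * Y := by
    calc A * X = (A * X)ᵀ := hX.transpose_mul.symm
      _ = ((A * Y) * (A * X))ᵀ := by rw [← Matrix.mul_assoc, hY.mul_mul_self]
      _ = (A * X) * (A * Y) := by
          rw [Matrix.transpose_mul, hX.transpose_mul, hY.transpose_mul]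
      _ = A * Y := by rw [← Matrix.mul_assoc, hX.mul_mul_self]
  have h2 : X * A = Y * A := by
    calc X * A = (X * A)ᵀ := hX.transpose_mul'.symm
      _ = ((X * A) * (Y * A))ᵀ := by
          rw [Matrix.mul_assoc X A (Y * A), ← Matrix.mul_assoc A Y A, hY.mul_mul_self]
      _ = (Y * A) * (X * A) := by
          rw [Matrix.transpose_mul, hX.transpose_mul', hY.transpose_mul']
      _ = Y * A := by
          rw [Matrix.mul_assoc Y A (X * A), ← Matrix.mul_assoc A X A, hX.mul_mul_self]
  calc X = X * A * X := hX.self_mul_mul.symm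
    _ = Y * A * Y := by rw [h2, Matrix.mul_assoc, h1, ← Matrix.mul_assoc]
    _ = Y := hY.self_mul_mul

/-- The Moore-Penrose pseudoinverse of `A`, the unique matrix with the four identities. -/
def pinv {n m : ℕ} (A : Matrix (Fin n) (Fin m) ℝ) : Matrix (Fin m) (Fin n) ℝ :=
  Classical.choose (exists_isMoorePenrose A)

theorem isMoorePenrose_pinv {n m : ℕ} (A : Matrix (Fin n) (Fin m) ℝ) :
    IsMoorePenrose A (pinv A) :=
  Classical.choose_spec (exists_isMoorePenrose A)

/-! ### Weighted graphs, incidence matrix, cutset projection -/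

/-- An undirected weighted graph on the nodes `Fin n`: a simple graph with a symmetric adjacency
matrix that is positive on the edges and zero elsewhere. -/
structure WeightedGraph (n : ℕ) where
  graph : SimpleGraph (Fin n)
  adj : Matrix (Fin n) (Fin n) ℝ
  adj_symm : adjᵀ = adj
  adj_pos : ∀ i j, graph.Adj i j → 0 < adj i j
  adj_zero : ∀ i j, ¬ graph.Adj i j → adj i j = 0

/-- The Laplacian `diag (row sums) - A`. -/
def WeightedGraph.laplacian {n : ℕ} (G : WeightedGraph n) : Matrix (Fin n) (Fin n) ℝ :=
  Matrix.diagonal (fun i => ∑ j, G.adj i j) - G.adj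

/-- An enumeration and orientation of the edges of `G`: every edge is listed exactly once,
the `e`-th one as going from `src e` to `tgt e`. -/
structure Orientation {n : ℕ} (G : WeightedGraph n) (m : ℕ) where
  src : Fin m → Fin n
  tgt : Fin m → Fin n
  bij : Set.BijOn (fun e => s(src e, tgt e)) Set.univ G.graph.edgeSet

section Incidence

variable {n m : ℕ} {G : WeightedGraph n} (O : Orientation G m)

/-- The oriented incidence matrix `B`: `+1` at the source and `-1` at the sink of an edge. -/
def incidence : Matrix (Fin n) (Fin m) ℝ :=
  Matrix.of fun i e => if i = O.src e then 1 else if i = O.tgt e then -1 else 0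

/-- The diagonal matrix `𝒜` of the edge weights. -/
def weightMatrix : Matrix (Fin m) (Fin m) ℝ :=
  Matrix.diagonal fun e => G.adj (O.src e) (O.tgt e)

/-- The subspace `Img (Bᵀ)` of the edge space. -/
def cutsetSpace : Submodule ℝ (Fin m → ℝ) :=
  LinearMap.range (incidence O)ᵀ.mulVecLin

/-- The subspace `Ker (B 𝒜)` of the edge space. -/
def weightedCycleSpace : Submodule ℝ (Fin m → ℝ) :=
  LinearMap.ker (incidence O * weightMatrix O).mulVecLin

theorem weight_pos (e : Fin m) : 0 < G.adj (O.src e) (O.tgt e) :=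
  G.adj_pos _ _ (O.bij.mapsTo (Set.mem_univ e))

/-- The edge space is the direct sum of `Img (Bᵀ)` and `Ker (B 𝒜)`. -/
theorem isCompl_cutsetSpace_weightedCycleSpace :
    IsCompl (cutsetSpace O) (weightedCycleSpace O) := by
  have hdisj : Disjoint (cutsetSpace O) (weightedCycleSpace O) := by
    rw [Submodule.disjoint_def]
    rintro y ⟨x, rfl⟩ hy
    have hy' : (incidence O * weightMatrix O) *ᵥ ((incidence O)ᵀ *ᵥ x) = 0 := hy
    change (incidence O)ᵀ *ᵥ x = 0
    set z := (incidence O)ᵀ *ᵥ x with hz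
    have h0 : ∑ e, G.adj (O.src e) (O.tgt e) * (z e) ^ 2 = 0 := by
      have h1 : x ⬝ᵥ ((incidence O * weightMatrix O) *ᵥ z) = 0 := by rw [hy']; simp
      rw [← Matrix.mulVec_mulVec, Matrix.dotProduct_mulVec, ← Matrix.mulVec_transpose, ← hz] at h1
      rw [← h1]
      simp only [dotProduct, weightMatrix, Matrix.mulVec_diagonal]
      exact Finset.sum_congr rfl fun e _ => by ring
    funext e
    have h2 := (Finset.sum_eq_zero_iff_of_nonneg
      (fun e _ => mul_nonneg (weight_pos O e).le (sq_nonneg (z e)))).mp h0 e (Finset.mem_univ e)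
    simpa [(weight_pos O e).ne'] using h2
  refine ⟨hdisj, codisjoint_iff.mpr (Submodule.eq_top_of_disjoint _ _ ?_ hdisj)⟩
  have hk := LinearMap.finrank_range_add_finrank_ker (incidence O * weightMatrix O).mulVecLin
  have hr : (incidence O * weightMatrix O).rank ≤ (incidence O)ᵀ.rank := by
    rw [Matrix.rank_transpose]
    exact Matrix.rank_mul_le_left _ _
  have hr' : Module.finrank ℝ (LinearMap.range (incidence O * weightMatrix O).mulVecLin) ≤
      Module.finrank ℝ (cutsetSpace O) := hr
  have hk' : Module.finrank ℝ (LinearMap.range (incidence O * weightMatrix O).mulVecLin) +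
      Module.finrank ℝ (weightedCycleSpace O) = Module.finrank ℝ (Fin m → ℝ) := hk
  omega

/-- The cutset projection `𝒫`: the oblique projection of the edge space onto `Img (Bᵀ)`
parallel to `Ker (B 𝒜)`. -/
def cutsetProjection : (Fin m → ℝ) →ₗ[ℝ] cutsetSpace O :=
  Submodule.projectionOnto (cutsetSpace O) (weightedCycleSpace O)
    (isCompl_cutsetSpace_weightedCycleSpace O)

end Incidence

/-- The subspace `1ₙ^⊥` of `ℝⁿ`. -/
def onePerp (n : ℕ) : Submodule ℝ (Fin n → ℝ) where
  carrier := {x | ∑ i, x i = 0}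
  add_mem' := by
    intro x y hx hy
    simp_all [Finset.sum_add_distrib]
  zero_mem' := by simp
  smul_mem' := by
    intro c x hx
    simp_all [← Finset.mul_sum]

/-! ### Phases: the torus modulo rotations -/

/-- The `n`-torus, with the sup distance built from the geodesic distance on the circle. -/
abbrev Torus (n : ℕ) : Type := Fin n → Real.Angle

/-- Rotation of all phases by the same angle. -/
def rot {n : ℕ} (s : Real.Angle) (θ : Torus n) : Torus n := fun i => θ i + s

/-- Two phase vectors are equivalent when they differ by a rotation. -/
def rotSetoid (n : ℕ) : Setoid (Torus n) where
  r θ θ' := ∃ s : Real.Angle, θ' = rot s θ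
  iseqv :=
    { refl := fun θ => ⟨0, by funext i; simp [rot]⟩
      symm := by
        rintro θ θ' ⟨s, rfl⟩
        exact ⟨-s, by funext i; simp [rot]⟩
      trans := by
        rintro θ θ' θ'' ⟨s, rfl⟩ ⟨t, rfl⟩
        exact ⟨s + t, by funext i; simp [rot, add_assoc]⟩ }

/-- The state space `𝕋ⁿ / rot`. -/
def PhaseSpace (n : ℕ) : Type := Quotient (rotSetoid n)

/-- The class `[θ]`. -/
def phaseClass {n : ℕ} (θ : Torus n) : PhaseSpace n := Quotient.mk (rotSetoid n) θ

/-- The point `exp (i x)` of the torus. -/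
def expTorus {n : ℕ} (x : Fin n → ℝ) : Torus n := fun i => (x i : Real.Angle)

/-- The distance on `𝕋ⁿ / rot` between `[θ]` and `Θ`. As rotations are isometries, this is the
distance from `θ` to the closest representative of `Θ`. -/
def distToClass {n : ℕ} (θ : Torus n) (Θ : PhaseSpace n) : ℝ :=
  Metric.infDist θ {θ' | phaseClass θ' = Θ}

section Model

variable {n m : ℕ} {G : WeightedGraph n} (O : Orientation G m) (ω : Fin n → ℝ)

/-- `sin (Bᵀ θ)` for `θ` on the torus: the sine of the phase difference along each edge. -/
def sinDiff (θ : Torus n) : Fin m → ℝ := fun e => (θ (O.src e) - θ (O.tgt e)).sin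

/-- The Kuramoto vector field `ω - B 𝒜 sin (Bᵀ θ)` on the torus. -/
def vectorField (θ : Torus n) : Fin n → ℝ :=
  ω - incidence O *ᵥ (weightMatrix O *ᵥ sinDiff O θ)

/-- `θ : ℝ≥0 → 𝕋ⁿ` solves the Kuramoto model: it has a differentiable lift to `ℝⁿ` whose
velocity at each time `t ≥ 0` is the Kuramoto vector field at `θ t`
(only the values of `θ` at times `t ≥ 0` matter). -/
def IsSolution (θ : ℝ → Torus n) : Prop :=
  ∃ x : ℝ → Fin n → ℝ, ∀ t, 0 ≤ t →
    θ t = expTorus (x t) ∧ HasDerivWithinAt x (vectorField O ω (θ t)) (Set.Ici 0) t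

/-- `Θ` is a synchronization manifold: `Θ = [θ]` with `ω = B 𝒜 sin (Bᵀ θ)`. -/
def IsSyncManifold (Θ : PhaseSpace n) : Prop :=
  ∃ θ : Torus n, phaseClass θ = Θ ∧ ω = incidence O *ᵥ (weightMatrix O *ᵥ sinDiff O θ)

/-- Local exponential stability of `Θ` in `𝕋ⁿ / rot`: solutions that start close to `Θ`
converge to it at a uniform exponential rate. -/
def IsLocallyExpStable (Θ : PhaseSpace n) : Prop :=
  ∃ δ > 0, ∃ c > 0, ∃ r > 0, ∀ θ : ℝ → Torus n, IsSolution O ω θ →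
    distToClass (θ 0) Θ < δ →
    ∀ t, 0 ≤ t → distToClass (θ t) Θ ≤ c * Real.exp (-r * t) * distToClass (θ 0) Θ

/-- `sin (Bᵀ x)` for `x ∈ ℝⁿ`, entrywise. -/
def sinIncidence (x : Fin n → ℝ) : Fin m → ℝ := fun e => Real.sin (((incidence O)ᵀ *ᵥ x) e)

/-- The nodal balance equation `ω = B 𝒜 sin (Bᵀ x)`. -/
def NodalBalance (x : Fin n → ℝ) : Prop :=
  ω = incidence O *ᵥ (weightMatrix O *ᵥ sinIncidence O x)

/-- The Kuramoto map `f_K : 1ₙ^⊥ → Img (Bᵀ)`, `f_K x = 𝒫 sin (Bᵀ x)`. -/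
def kuramotoMap (x : onePerp n) : cutsetSpace O :=
  cutsetProjection O (sinIncidence O x)

/-- The edge balance equation `Bᵀ L† ω = 𝒫 sin (Bᵀ x)`. -/
def EdgeBalance (x : onePerp n) : Prop :=
  (incidence O)ᵀ *ᵥ (pinv G.laplacian *ᵥ ω) = (kuramotoMap O x : Fin m → ℝ)

/-- `B^G(γ) = {x ∈ 1ₙ^⊥ : ‖Bᵀ x‖_∞ ≤ γ}` (the norm on `Fin m → ℝ` is the sup norm). -/
def cohesiveBall (γ : ℝ) : Set (onePerp n) :=
  {x | ‖(incidence O)ᵀ *ᵥ (x : Fin n → ℝ)‖ ≤ γ}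

/-- The identification map `x ↦ [exp (i x)]` from `1ₙ^⊥` to `𝕋ⁿ / rot`. -/
def toPhase (x : onePerp n) : PhaseSpace n := phaseClass (expTorus (x : Fin n → ℝ))

/-- The embedded cohesive subset `S^G(γ)` of `𝕋ⁿ / rot`: the classes of `exp (i x)` for
`x ∈ B^G(γ)`. -/
def embeddedCohesive (γ : ℝ) : Set (PhaseSpace n) := toPhase '' cohesiveBall O γ

end Model

end Kuramoto

end

/-!
The nodal and the edge balance equations are equivalent because `L = B 𝒜 Bᵀ`
(`laplacian_eq_incidence_mul`), whence `𝒫 = Bᵀ L† B 𝒜` (`coe_cutsetProjection`), and because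
`L L†` fixes `1ₙ^⊥ = Img L` on a connected graph (`laplacian_mulVec_pinv_mulVec`).

Everything else rests on the pairing
`⟨z, B 𝒜 (sin Bᵀx - sin Bᵀy)⟩ = ∑ₑ aₑ (Bᵀz)ₑ (sin (Bᵀx)ₑ - sin (Bᵀy)ₑ)`
(`dotProduct_incidence_mulVec`) and on the monotonicity of the sine on `[-π/2, π/2]`.

* With `z = x - y` and equal values of `f_K`, the left-hand side vanishes, so `Bᵀx = Bᵀy` on
  `B^G(γ)`, and connectedness gives `x = y` (`injOn_kuramotoMap`). Through the edge balance
  equation this is also the uniqueness of the synchronization manifold.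
* Along a solution near a synchronization manifold `x`, lift the difference to `ℝⁿ` and remove
  its mean, which the flow conserves. The resulting displacement `z ∈ 1ₙ^⊥` satisfies
  `z' = -B 𝒜 (sin Bᵀ(x+z) - sin Bᵀx)`. The sine has slope at least `cos (γ + η) > 0` on
  `[-(γ+η), γ+η]` for some `η > 0`, so by the Poincaré inequality of the connected graph
  (`exists_poincare`) the pairing is at least `r |z|²` as long as `‖Bᵀz‖_∞ ≤ η`
  (`exists_dissipation`). Hence `|z|²` decays exponentially (`sum_sq_le_exp_of_dissipation`),
  and with it the distance in `𝕋ⁿ/rot`.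
-/

open scoped Matrix

noncomputable section

namespace Kuramoto

/-! ### Incidence, weights and the Laplacian -/

section Graph

variable {n m : ℕ} {G : WeightedGraph n} (O : Orientation G m)

theorem Orientation.adj_src_tgt (e : Fin m) : G.graph.Adj (O.src e) (O.tgt e) :=
  O.bij.mapsTo (Set.mem_univ e)

theorem Orientation.src_ne_tgt (e : Fin m) : O.src e ≠ O.tgt e :=
  (O.adj_src_tgt e).ne

theorem Orientation.exists_of_adj {i j : Fin n} (h : G.graph.Adj i j) :
    ∃ e, (O.src e = i ∧ O.tgt e = j) ∨ (O.src e = j ∧ O.tgt e = i) := by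
  obtain ⟨e, -, he⟩ := O.bij.surjOn (show s(i, j) ∈ G.graph.edgeSet from h)
  exact ⟨e, Sym2.eq_iff.mp he⟩

theorem incidence_transpose_mulVec (x : Fin n → ℝ) (e : Fin m) :
    ((incidence O)ᵀ *ᵥ x) e = x (O.src e) - x (O.tgt e) := by
  have h : ∀ i, (incidence O)ᵀ e i * x i =
      (if i = O.src e then x i else 0) - (if i = O.tgt e then x i else 0) := by
    intro i
    have := O.src_ne_tgt e
    simp only [Matrix.transpose_apply, incidence, Matrix.of_apply]
    split_ifs with h1 h2 <;> simp_all
  simp only [Matrix.mulVec, dotProduct, h, Finset.sum_sub_distrib]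
  simp

/-- The pairing of a node potential `x` with the net outflow of the weighted edge flow `y`
(discrete integration by parts). -/
theorem dotProduct_incidence_mulVec (x : Fin n → ℝ) (y : Fin m → ℝ) :
    x ⬝ᵥ (incidence O *ᵥ (weightMatrix O *ᵥ y)) =
      ∑ e, G.adj (O.src e) (O.tgt e) * ((x (O.src e) - x (O.tgt e)) * y e) := by
  rw [Matrix.dotProduct_mulVec, ← Matrix.mulVec_transpose]
  simp only [dotProduct, weightMatrix, Matrix.mulVec_diagonal, incidence_transpose_mulVec]
  exact Finset.sum_congr rfl fun e _ => by ring

theorem sum_incidence_mulVec (y : Fin m → ℝ) :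
    ∑ i, (incidence O *ᵥ (weightMatrix O *ᵥ y)) i = 0 := by
  have := dotProduct_incidence_mulVec O 1 y
  simpa [dotProduct] using this

theorem WeightedGraph.adj_comm (G : WeightedGraph n) (i j : Fin n) : G.adj i j = G.adj j i := by
  conv_lhs => rw [← G.adj_symm]
  rfl

/-- A sum over ordered pairs of adjacent nodes is a sum over the edges, each contributing both
of its orientations. -/
theorem Orientation.sum_sum_eq (f : Fin n → Fin n → ℝ)
    (hf : ∀ i j, ¬ G.graph.Adj i j → f i j = 0) :
    ∑ i, ∑ j, f i j = ∑ e, (f (O.src e) (O.tgt e) + f (O.tgt e) (O.src e)) := by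
  have h : ∑ q : Fin m × Bool,
      (if q.2 then f (O.src q.1) (O.tgt q.1) else f (O.tgt q.1) (O.src q.1)) =
      ∑ p : Fin n × Fin n, f p.1 p.2 := by
    refine Finset.sum_of_injOn
      (fun q => if q.2 then (O.src q.1, O.tgt q.1) else (O.tgt q.1, O.src q.1)) ?_ ?_ ?_ ?_
    · rintro ⟨e, b⟩ - ⟨e', b'⟩ - h
      have hs : s(O.src e, O.tgt e) = s(O.src e', O.tgt e') := by
        rw [Sym2.eq_iff]
        cases b <;> cases b' <;> simp_all
      have he : e = e' := O.bij.injOn (Set.mem_univ e) (Set.mem_univ e') hs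
      subst he
      have h1 := O.src_ne_tgt e
      have h2 := h1.symm
      cases b <;> cases b' <;> simp_all
    · intro _ _
      simp
    · rintro ⟨i, j⟩ - h
      refine hf i j fun hij => h ?_
      obtain ⟨e, ⟨rfl, rfl⟩ | ⟨rfl, rfl⟩⟩ := O.exists_of_adj hij
      · exact ⟨(e, true), by simp⟩
      · exact ⟨(e, false), by simp⟩
    · rintro ⟨e, b⟩ -
      cases b <;> simp
  rw [← Fintype.sum_prod_type' f, ← h, Fintype.sum_prod_type]
  simp

/-- The factorization `L = B 𝒜 Bᵀ` of the Laplacian. -/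
theorem laplacian_eq_incidence_mul :
    G.laplacian = incidence O * weightMatrix O * (incidence O)ᵀ := by
  ext i k
  -- The summand is chosen so that its two orientations add up to `aₑ B_{ie} B_{ke}`.
  have h := O.sum_sum_eq (fun p q => G.adj p q *
    ((if i = p then 1 else 0) * ((if k = p then 1 else 0) - (if k = q then 1 else 0))))
    (fun p q hpq => by simp [G.adj_zero p q hpq])
  have hl : G.laplacian i k = ∑ p, ∑ q, G.adj p q *
    ((if i = p then 1 else 0) * ((if k = p then 1 else 0) - (if k = q then 1 else 0))) := by
    rw [Finset.sum_eq_single i]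
    · simp only [mul_sub, Finset.sum_sub_distrib, WeightedGraph.laplacian, Matrix.sub_apply,
        Matrix.diagonal_apply]
      by_cases hik : i = k
      · subst hik; simp
      · simp [hik, Ne.symm hik]
    · intro p _ hp
      simp [Ne.symm hp]
    · simp
  rw [hl, h, Matrix.mul_apply]
  refine Finset.sum_congr rfl fun e _ => ?_
  have h1 := O.src_ne_tgt e
  simp only [weightMatrix, Matrix.mul_diagonal, Matrix.transpose_apply, incidence,
    Matrix.of_apply]
  rw [G.adj_comm (O.tgt e) (O.src e)]
  by_cases h2 : i = O.src e <;> by_cases h3 : i = O.tgt e <;> by_cases h4 : k = O.src e <;>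
    by_cases h5 : k = O.tgt e <;> simp_all

theorem laplacian_mulVec (x : Fin n → ℝ) : G.laplacian *ᵥ x =
    incidence O *ᵥ (weightMatrix O *ᵥ ((incidence O)ᵀ *ᵥ x)) := by
  rw [laplacian_eq_incidence_mul O, Matrix.mulVec_mulVec, Matrix.mulVec_mulVec, Matrix.mul_assoc]

theorem laplacian_transpose : G.laplacianᵀ = G.laplacian := by
  simp [WeightedGraph.laplacian, G.adj_symm]

/-- The kernel of the Laplacian is the kernel of `Bᵀ`, as `xᵀ L x = ∑ₑ aₑ (Bᵀ x)ₑ²`. -/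
theorem incidence_transpose_mulVec_eq_zero {x : Fin n → ℝ} (h : G.laplacian *ᵥ x = 0) :
    (incidence O)ᵀ *ᵥ x = 0 := by
  rw [laplacian_mulVec O] at h
  exact Submodule.disjoint_def.mp (isCompl_cutsetSpace_weightedCycleSpace O).disjoint _ ⟨x, rfl⟩
    (by simpa [weightedCycleSpace] using h)

/-- On a connected graph, potentials in `1ₙ^⊥` without potential differences vanish. -/
theorem eq_zero_of_incidence_transpose_mulVec (hG : G.graph.Connected) {x : Fin n → ℝ}
    (hx : x ∈ onePerp n) (h : (incidence O)ᵀ *ᵥ x = 0) : x = 0 := by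
  have hadj : ∀ i j, G.graph.Adj i j → x i = x j := by
    intro i j hij
    obtain ⟨e, he⟩ := O.exists_of_adj hij
    have := congrFun h e
    rw [incidence_transpose_mulVec, Pi.zero_apply] at this
    obtain ⟨rfl, rfl⟩ | ⟨rfl, rfl⟩ := he <;> linarith
  have hconst : ∀ i j, x i = x j := fun i j => by
    obtain ⟨w⟩ := hG.preconnected i j
    induction w with
    | nil => rfl
    | cons h _ ih => exact (hadj _ _ h).trans ih
  have hsum : ∑ i, x i = 0 := hx
  funext i
  rw [Finset.sum_congr rfl fun j _ => hconst j i] at hsum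
  have hn : (n : ℝ) ≠ 0 := by
    have := i.pos
    positivity
  simpa [hn] using hsum

/-- On a connected graph `L L†` fixes `1ₙ^⊥`. -/
theorem laplacian_mulVec_pinv_mulVec {n m : ℕ} {G : WeightedGraph n} (O : Orientation G m)
    (hG : G.graph.Connected) {ω : Fin n → ℝ} (hω : ω ∈ onePerp n) :
    G.laplacian *ᵥ (pinv G.laplacian *ᵥ ω) = ω := by
  have hP := isMoorePenrose_pinv G.laplacian
  have hL : G.laplacian * (G.laplacian * pinv G.laplacian) = G.laplacian := by
    have := congrArg Matrix.transpose hP.mul_mul_self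
    rwa [Matrix.transpose_mul, hP.transpose_mul, laplacian_transpose] at this
  have hmem : ω - G.laplacian *ᵥ (pinv G.laplacian *ᵥ ω) ∈ onePerp n := by
    refine Submodule.sub_mem _ hω ?_
    rw [laplacian_mulVec O]
    exact sum_incidence_mulVec O _
  refine (sub_eq_zero.mp (eq_zero_of_incidence_transpose_mulVec O hG hmem
    (incidence_transpose_mulVec_eq_zero O ?_))).symm
  rw [Matrix.mulVec_sub, Matrix.mulVec_mulVec, Matrix.mulVec_mulVec, Matrix.mul_assoc, hL,
    sub_self]

/-- `𝒫` does not change the nodal outflow `B 𝒜 y`. -/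
theorem incidence_mulVec_cutsetProjection (y : Fin m → ℝ) :
    incidence O *ᵥ (weightMatrix O *ᵥ (cutsetProjection O y : Fin m → ℝ)) =
      incidence O *ᵥ (weightMatrix O *ᵥ y) := by
  have h : y - cutsetProjection O y ∈ weightedCycleSpace O := by
    rw [← Submodule.projectionOnto_apply_eq_zero_iff (isCompl_cutsetSpace_weightedCycleSpace O),
      map_sub, sub_eq_zero]
    exact (Submodule.projectionOnto_apply_left _ _).symm
  have h' : (incidence O * weightMatrix O) *ᵥ (y - cutsetProjection O y) = 0 := h
  rw [Matrix.mulVec_sub, sub_eq_zero, ← Matrix.mulVec_mulVec, ← Matrix.mulVec_mulVec] at h'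
  exact h'.symm

/-- `𝒫 = Bᵀ L† B 𝒜`. -/
theorem coe_cutsetProjection (y : Fin m → ℝ) : (cutsetProjection O y : Fin m → ℝ) =
    (incidence O)ᵀ *ᵥ (pinv G.laplacian *ᵥ (incidence O *ᵥ (weightMatrix O *ᵥ y))) := by
  obtain ⟨z, hz⟩ := (cutsetProjection O y).2
  have hz' : (incidence O)ᵀ *ᵥ z = cutsetProjection O y := hz
  rw [← incidence_mulVec_cutsetProjection O y, ← hz', ← laplacian_mulVec O]
  have h0 : G.laplacian *ᵥ (z - pinv G.laplacian *ᵥ (G.laplacian *ᵥ z)) = 0 := by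
    rw [Matrix.mulVec_sub, Matrix.mulVec_mulVec, Matrix.mulVec_mulVec,
      (isMoorePenrose_pinv _).mul_mul_self, sub_self]
  have h1 := incidence_transpose_mulVec_eq_zero O h0
  rwa [Matrix.mulVec_sub, sub_eq_zero] at h1

end Graph

/-! ### Balance equations and the Kuramoto map -/

section Equilibria

variable {n m : ℕ} {G : WeightedGraph n} (O : Orientation G m) (ω : Fin n → ℝ)

theorem sinDiff_rot (s : Real.Angle) (θ : Torus n) : sinDiff O (rot s θ) = sinDiff O θ := by
  funext e
  simp [sinDiff, rot]

theorem sinDiff_expTorus (x : Fin n → ℝ) : sinDiff O (expTorus x) = sinIncidence O x := by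
  funext e
  simp only [sinDiff, expTorus, sinIncidence, incidence_transpose_mulVec]
  rw [← Real.Angle.coe_sub, Real.Angle.sin_coe]

theorem phaseClass_eq_iff {θ θ' : Torus n} :
    phaseClass θ = phaseClass θ' ↔ ∃ s : Real.Angle, θ' = rot s θ :=
  Quotient.eq (r := rotSetoid n)

theorem isSyncManifold_toPhase_iff (x : onePerp n) :
    IsSyncManifold O ω (toPhase x) ↔ NodalBalance O ω x := by
  constructor
  · rintro ⟨θ, hθ, h⟩
    obtain ⟨s, hs⟩ := phaseClass_eq_iff.mp hθ
    rw [NodalBalance, ← sinDiff_expTorus, hs, sinDiff_rot]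
    exact h
  · intro h
    exact ⟨expTorus x, rfl, by rw [sinDiff_expTorus]; exact h⟩

theorem nodalBalance_iff_edgeBalance (hG : G.graph.Connected) (hω : ω ∈ onePerp n)
    (x : onePerp n) : NodalBalance O ω x ↔ EdgeBalance O ω x := by
  rw [NodalBalance, EdgeBalance, kuramotoMap]
  constructor
  · intro h
    rw [coe_cutsetProjection, ← h]
  · intro h
    rw [← incidence_mulVec_cutsetProjection, ← h, ← laplacian_mulVec,
      laplacian_mulVec_pinv_mulVec O hG hω]

theorem analyticOnNhd_kuramotoMap : AnalyticOnNhd ℝ (kuramotoMap O) Set.univ := by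
  have hsin : AnalyticOnNhd ℝ (fun x : onePerp n => sinIncidence O x) Set.univ := by
    refine AnalyticOnNhd.pi fun e => ?_
    let φ : onePerp n →L[ℝ] ℝ := LinearMap.toContinuousLinearMap
      (LinearMap.proj e ∘ₗ (incidence O)ᵀ.mulVecLin ∘ₗ (onePerp n).subtype)
    exact Real.analyticOnNhd_sin.comp (φ.analyticOnNhd Set.univ) (Set.mapsTo_univ _ _)
  exact ((LinearMap.toContinuousLinearMap (cutsetProjection O)).analyticOnNhd Set.univ).comp hsin
    (Set.mapsTo_univ _ _)

theorem abs_sub_le_of_mem_cohesiveBall {γ : ℝ} {x : onePerp n} (hx : x ∈ cohesiveBall O γ)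
    (e : Fin m) : |(x : Fin n → ℝ) (O.src e) - (x : Fin n → ℝ) (O.tgt e)| ≤ γ := by
  have h := (norm_le_pi_norm ((incidence O)ᵀ *ᵥ (x : Fin n → ℝ)) e).trans hx
  rwa [incidence_transpose_mulVec, Real.norm_eq_abs] at h

/-- The Kuramoto map is injective on `B^G(γ)`: pairing the difference of two values with
`𝒜 Bᵀ (x - y)` gives a sum of products `aₑ (u - v) (sin u - sin v)`, which are nonnegative and
vanish only for `u = v`, the sine being strictly increasing on `[-π/2, π/2]`. -/
theorem injOn_kuramotoMap (hG : G.graph.Connected) {γ : ℝ} (hγ : γ < Real.pi / 2) :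
    Set.InjOn (kuramotoMap O) (cohesiveBall O γ) := by
  intro x hx y hy hxy
  have hflow : incidence O *ᵥ (weightMatrix O *ᵥ (sinIncidence O x - sinIncidence O y)) = 0 := by
    rw [Matrix.mulVec_sub, Matrix.mulVec_sub, sub_eq_zero, ← incidence_mulVec_cutsetProjection O
      (sinIncidence O x), ← incidence_mulVec_cutsetProjection O (sinIncidence O y)]
    exact congrArg (fun z : cutsetSpace O => incidence O *ᵥ (weightMatrix O *ᵥ (z : Fin m → ℝ))) hxy
  have hsum := dotProduct_incidence_mulVec O ((x : Fin n → ℝ) - y)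
    (sinIncidence O x - sinIncidence O y)
  rw [hflow, dotProduct_zero] at hsum
  have hmem : ∀ z ∈ cohesiveBall O γ, ∀ e, ((incidence O)ᵀ *ᵥ (z : Fin n → ℝ)) e ∈
      Set.Icc (-(Real.pi / 2)) (Real.pi / 2) := by
    intro z hz e
    have h := abs_le.mp (abs_sub_le_of_mem_cohesiveBall O hz e)
    rw [incidence_transpose_mulVec]
    constructor <;> linarith
  have hterm : ∀ e, G.adj (O.src e) (O.tgt e) *
      ((((x : Fin n → ℝ) - y) (O.src e) - ((x : Fin n → ℝ) - y) (O.tgt e)) *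
        (sinIncidence O x - sinIncidence O y) e) =
      G.adj (O.src e) (O.tgt e) *
      ((((incidence O)ᵀ *ᵥ (x : Fin n → ℝ)) e - ((incidence O)ᵀ *ᵥ (y : Fin n → ℝ)) e) *
        (Real.sin (((incidence O)ᵀ *ᵥ (x : Fin n → ℝ)) e) -
          Real.sin (((incidence O)ᵀ *ᵥ (y : Fin n → ℝ)) e))) := by
    intro e
    simp only [incidence_transpose_mulVec, sinIncidence, Pi.sub_apply]
    ring
  rw [Finset.sum_congr rfl fun e _ => hterm e] at hsum
  have hpos : ∀ u v : ℝ, u ∈ Set.Icc (-(Real.pi / 2)) (Real.pi / 2) →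
      v ∈ Set.Icc (-(Real.pi / 2)) (Real.pi / 2) → u ≠ v →
      0 < (u - v) * (Real.sin u - Real.sin v) := by
    intro u v hu hv huv
    rcases huv.lt_or_gt with h | h
    · exact mul_pos_of_neg_of_neg (sub_neg.mpr h)
        (sub_neg.mpr (Real.strictMonoOn_sin hu hv h))
    · exact mul_pos (sub_pos.mpr h) (sub_pos.mpr (Real.strictMonoOn_sin hv hu h))
  have hnonneg : ∀ u v : ℝ, u ∈ Set.Icc (-(Real.pi / 2)) (Real.pi / 2) →
      v ∈ Set.Icc (-(Real.pi / 2)) (Real.pi / 2) → 0 ≤ (u - v) * (Real.sin u - Real.sin v) := by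
    intro u v hu hv
    by_cases h : u = v
    · simp [h]
    · exact (hpos u v hu hv h).le
  have hzero := (Finset.sum_eq_zero_iff_of_nonneg fun e _ => mul_nonneg (weight_pos O e).le
    (hnonneg _ _ (hmem x hx e) (hmem y hy e))).mp hsum.symm
  have hB : (incidence O)ᵀ *ᵥ ((x : Fin n → ℝ) - y) = 0 := by
    rw [Matrix.mulVec_sub, sub_eq_zero]
    funext e
    by_contra hne
    exact (mul_pos (weight_pos O e) (hpos _ _ (hmem x hx e) (hmem y hy e) hne)).ne'
      (hzero e (Finset.mem_univ e))
  exact Subtype.ext (sub_eq_zero.mp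
    (eq_zero_of_incidence_transpose_mulVec O hG (x - y).2 hB))

end Equilibria

/-! ### Exponential stability -/

section Stability

/-- Strong monotonicity of the sine away from `±π/2`. -/
theorem cos_mul_sq_le_mul_sin_add_sub_sin {γ η u w : ℝ} (hγη : γ + η ≤ Real.pi) (hu : |u| ≤ γ)
    (hw : |w| ≤ η) : Real.cos (γ + η) * w ^ 2 ≤ w * (Real.sin (u + w) - Real.sin u) := by
  have hmono : MonotoneOn (fun t => Real.sin t - Real.cos (γ + η) * t)
      (Set.Icc (-(γ + η)) (γ + η)) := by
    refine monotoneOn_of_deriv_nonneg (convex_Icc _ _) (by fun_prop) (by fun_prop) ?_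
    intro t ht
    rw [interior_Icc] at ht
    have hd : HasDerivAt (fun t => Real.sin t - Real.cos (γ + η) * t)
        (Real.cos t - Real.cos (γ + η) * 1) t :=
      (Real.hasDerivAt_sin t).sub ((hasDerivAt_id t).const_mul _)
    have hc : Real.cos (γ + η) ≤ Real.cos t := by
      rw [← Real.cos_abs t]
      exact Real.cos_le_cos_of_nonneg_of_le_pi (abs_nonneg t) hγη (abs_lt.mpr ht).le
    rw [hd.deriv]
    linarith
  obtain ⟨hu1, hu2⟩ := abs_le.mp hu
  obtain ⟨hw1, hw2⟩ := abs_le.mp hw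
  have hmu : u ∈ Set.Icc (-(γ + η)) (γ + η) := ⟨by linarith, by linarith⟩
  have hmw : u + w ∈ Set.Icc (-(γ + η)) (γ + η) := ⟨by linarith, by linarith⟩
  rcases le_total 0 w with h | h
  · have := hmono hmu hmw (by linarith)
    simp only at this
    nlinarith
  · have := hmono hmw hmu (by linarith)
    simp only at this
    nlinarith

variable {n m : ℕ} {G : WeightedGraph n} (O : Orientation G m) (ω : Fin n → ℝ)

/-- The Poincaré inequality on a connected graph: positivity of the algebraic connectivity. -/
theorem exists_poincare (hG : G.graph.Connected) : ∃ l > 0, ∀ z ∈ onePerp n,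
    l * ∑ i, z i ^ 2 ≤ ∑ e, G.adj (O.src e) (O.tgt e) * (z (O.src e) - z (O.tgt e)) ^ 2 := by
  let T : onePerp n →ₗ[ℝ] (Fin m → ℝ) :=
    (Matrix.diagonal fun e => √(G.adj (O.src e) (O.tgt e))).mulVecLin ∘ₗ
      (incidence O)ᵀ.mulVecLin ∘ₗ (onePerp n).subtype
  have hT : ∀ z e, T z e = √(G.adj (O.src e) (O.tgt e)) *
      ((z : Fin n → ℝ) (O.src e) - (z : Fin n → ℝ) (O.tgt e)) := by
    intro z e
    have h : T z e = (Matrix.diagonal (fun e => √(G.adj (O.src e) (O.tgt e))) *ᵥ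
        ((incidence O)ᵀ *ᵥ (z : Fin n → ℝ))) e := rfl
    rw [h, Matrix.mulVec_diagonal, incidence_transpose_mulVec]
  have hker : T.ker = ⊥ := by
    rw [LinearMap.ker_eq_bot']
    intro z hz
    refine Subtype.ext (eq_zero_of_incidence_transpose_mulVec O hG z.2 ?_)
    funext e
    have := congrFun hz e
    rw [hT, Pi.zero_apply] at this
    rw [incidence_transpose_mulVec]
    exact (mul_eq_zero.mp this).resolve_left (Real.sqrt_pos.mpr (weight_pos O e)).ne'
  obtain ⟨K, hK, hanti⟩ := T.exists_antilipschitzWith hker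
  have hn : 0 < (n : ℝ) := by
    obtain ⟨i⟩ := hG.nonempty
    have := i.pos
    positivity
  have hK' : 0 < (K : ℝ) := hK
  refine ⟨(n * (K : ℝ) ^ 2)⁻¹, by positivity, fun z hz => ?_⟩
  set S := ∑ e, G.adj (O.src e) (O.tgt e) * (z (O.src e) - z (O.tgt e)) ^ 2 with hS
  have hnn : ∀ e ∈ Finset.univ,
      0 ≤ G.adj (O.src e) (O.tgt e) * (z (O.src e) - z (O.tgt e)) ^ 2 :=
    fun e _ => mul_nonneg (weight_pos O e).le (sq_nonneg _)
  have hTS : ‖T ⟨z, hz⟩‖ ≤ √S := by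
    refine (pi_norm_le_iff_of_nonneg (Real.sqrt_nonneg _)).mpr fun e => ?_
    rw [Real.norm_eq_abs]
    refine Real.abs_le_sqrt ?_
    rw [hT, mul_pow, Real.sq_sqrt (weight_pos O e).le]
    exact Finset.single_le_sum hnn (Finset.mem_univ e)
  have hzT : ‖z‖ ≤ K * ‖T ⟨z, hz⟩‖ := by
    simpa using hanti.le_mul_dist ⟨z, hz⟩ 0
  have hz2 : ∀ i, z i ^ 2 ≤ (K : ℝ) ^ 2 * S := by
    intro i
    have h1 : |z i| ≤ K * √S :=
      (norm_le_pi_norm z i).trans (hzT.trans (mul_le_mul_of_nonneg_left hTS hK'.le))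
    have h2 := pow_le_pow_left₀ (abs_nonneg _) h1 2
    rwa [sq_abs, mul_pow, Real.sq_sqrt (Finset.sum_nonneg hnn)] at h2
  have hsum : ∑ i, z i ^ 2 ≤ n * ((K : ℝ) ^ 2 * S) := by
    simpa using Finset.sum_le_sum fun i (_ : i ∈ Finset.univ) => hz2 i
  rw [inv_mul_le_iff₀ (by positivity), mul_assoc]
  exact hsum

/-- Near `x ∈ B^G(γ)` the Kuramoto flow dissipates the squared distance to `x`, at a rate which
is the product of the algebraic connectivity and the least slope of the sine in play. -/
theorem exists_dissipation (hG : G.graph.Connected) {γ η : ℝ} (hη : 0 ≤ η) (hγ : 0 ≤ γ)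
    (hγη : γ + η < Real.pi / 2) :
    ∃ r > 0, ∀ x ∈ cohesiveBall O γ, ∀ z ∈ onePerp n,
      (∀ e, |z (O.src e) - z (O.tgt e)| ≤ η) →
      r * ∑ i, z i ^ 2 ≤ z ⬝ᵥ (incidence O *ᵥ (weightMatrix O *ᵥ
        (sinIncidence O (x + z) - sinIncidence O x))) := by
  obtain ⟨l, hl, hpoin⟩ := exists_poincare O hG
  have hpi := Real.pi_pos
  have hκ : 0 < Real.cos (γ + η) := Real.cos_pos_of_mem_Ioo ⟨by linarith, hγη⟩
  refine ⟨Real.cos (γ + η) * l, by positivity, fun x hx z hz hze => ?_⟩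
  rw [dotProduct_incidence_mulVec, mul_assoc]
  refine (mul_le_mul_of_nonneg_left (hpoin z hz) hκ.le).trans ?_
  rw [Finset.mul_sum]
  refine Finset.sum_le_sum fun e _ => ?_
  have h := cos_mul_sq_le_mul_sin_add_sub_sin (by linarith)
    (abs_sub_le_of_mem_cohesiveBall O hx e) (hze e)
  have he : (sinIncidence O (x + z) - sinIncidence O x) e =
      Real.sin (((x : Fin n → ℝ) (O.src e) - (x : Fin n → ℝ) (O.tgt e)) +
        (z (O.src e) - z (O.tgt e))) -
      Real.sin ((x : Fin n → ℝ) (O.src e) - (x : Fin n → ℝ) (O.tgt e)) := by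
    simp only [sinIncidence, Pi.sub_apply, incidence_transpose_mulVec, Pi.add_apply]
    ring_nf
  rw [he, mul_left_comm]
  exact mul_le_mul_of_nonneg_left h (weight_pos O e).le

/-- Exponential decay of the displacement `z` from an equilibrium `x ∈ B^G(γ)`. The comparison
function `C e^{-rt}` stays below the level `C`, so the differential inequality for `∑ zᵢ²` is
needed only where `∑ zᵢ² ≤ C`, which is inside the region of dissipation. -/
theorem sum_sq_le_exp_of_dissipation {x : onePerp n} {r η C : ℝ} (hr : 0 < r) (hC : 0 < C)
    (hCη : 2 * √C ≤ η)
    (hdiss : ∀ z ∈ onePerp n, (∀ e, |z (O.src e) - z (O.tgt e)| ≤ η) →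
      r * ∑ i, z i ^ 2 ≤ z ⬝ᵥ (incidence O *ᵥ (weightMatrix O *ᵥ
        (sinIncidence O (x + z) - sinIncidence O x))))
    {z : ℝ → Fin n → ℝ} (hz0 : z 0 ∈ onePerp n) (hzC : ∑ i, z 0 i ^ 2 ≤ C)
    (hz : ∀ t, 0 ≤ t → HasDerivWithinAt z (-(incidence O *ᵥ (weightMatrix O *ᵥ
        (sinIncidence O (x + z t) - sinIncidence O x)))) (Set.Ici 0) t)
    {t : ℝ} (ht : 0 ≤ t) : ∑ i, z t i ^ 2 ≤ C * Real.exp (-r * t) := by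
  have hzi : ∀ i s, 0 ≤ s → HasDerivWithinAt (fun s => z s i) ((-(incidence O *ᵥ
      (weightMatrix O *ᵥ (sinIncidence O (x + z s) - sinIncidence O x)))) i) (Set.Ici 0) s :=
    fun i s hs => hasDerivWithinAt_pi.mp (hz s hs) i
  have hmem : ∀ s, 0 ≤ s → z s ∈ onePerp n := by
    intro s hs
    have hd : ∀ u, 0 ≤ u → HasDerivWithinAt (fun u => ∑ i, z u i) 0 (Set.Ici 0) u := by
      intro u hu
      have h := HasDerivWithinAt.fun_sum (u := Finset.univ) fun i _ => hzi i u hu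
      have h0 : ∑ i, (-(incidence O *ᵥ (weightMatrix O *ᵥ
          (sinIncidence O (x + z u) - sinIncidence O x)))) i = 0 := by
        simp only [Pi.neg_apply, Finset.sum_neg_distrib, sum_incidence_mulVec, neg_zero]
      rwa [h0] at h
    have hconst := constant_of_has_deriv_right_zero (a := 0) (b := s)
      (fun u hu => (hd u hu.1).continuousWithinAt.mono Set.Icc_subset_Ici_self)
      (fun u hu => (hd u hu.1).mono (Set.Ici_subset_Ici.mpr hu.1)) s ⟨hs, le_rfl⟩
    exact hconst.trans hz0
  have hV : ∀ s, 0 ≤ s → HasDerivWithinAt (fun s => ∑ i, z s i ^ 2)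
      (-2 * (z s ⬝ᵥ (incidence O *ᵥ (weightMatrix O *ᵥ
        (sinIncidence O (x + z s) - sinIncidence O x))))) (Set.Ici 0) s := by
    intro s hs
    have h := HasDerivWithinAt.fun_sum (u := Finset.univ) fun i _ => (hzi i s hs).fun_pow 2
    refine h.congr_deriv ?_
    simp only [dotProduct, Finset.mul_sum, Pi.neg_apply]
    exact Finset.sum_congr rfl fun i _ => by ring
  have hB : ∀ s : ℝ, HasDerivAt (fun s => C * Real.exp (-r * s))
      (C * (Real.exp (-r * s) * (-r * 1))) s :=
    fun s => (((hasDerivAt_id s).const_mul (-r)).exp).const_mul C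
  refine image_le_of_deriv_right_lt_deriv_boundary' (a := 0) (b := t)
    (fun s hs => (hV s hs.1).continuousWithinAt.mono Set.Icc_subset_Ici_self)
    (fun s hs => (hV s hs.1).mono (Set.Ici_subset_Ici.mpr hs.1)) (by simpa using hzC)
    (fun s _ => (hB s).continuousAt.continuousWithinAt) (fun s _ => (hB s).hasDerivWithinAt)
    ?_ ⟨ht, le_rfl⟩
  intro s hs hsB
  have hpos : 0 < C * Real.exp (-r * s) := by positivity
  have hle : ∑ i, z s i ^ 2 ≤ C := by
    rw [hsB]
    refine mul_le_of_le_one_right hC.le (Real.exp_le_one_iff.mpr ?_)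
    nlinarith [hs.1]
  have habs : ∀ i, |z s i| ≤ √C := fun i => Real.abs_le_sqrt
    ((Finset.single_le_sum (f := fun i => z s i ^ 2) (fun i _ => sq_nonneg _)
      (Finset.mem_univ i)).trans hle)
  have h := hdiss (z s) (hmem s hs.1) fun e => by
    have := abs_sub (z s (O.src e)) (z s (O.tgt e))
    linarith [habs (O.src e), habs (O.tgt e)]
  rw [hsB] at h
  nlinarith

theorem norm_coe_angle_le (y : ℝ) : ‖(y : Real.Angle)‖ ≤ |y| := by
  have hp : 0 < 2 * Real.pi := Real.two_pi_pos
  have hn : ‖(y : Real.Angle)‖ = |y - round ((2 * Real.pi)⁻¹ * y) * (2 * Real.pi)| :=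
    AddCircle.norm_eq (2 * Real.pi)
  rw [hn]
  set u := (2 * Real.pi)⁻¹ * y with hu
  have hy : y = 2 * Real.pi * u := by rw [hu]; field_simp
  clear_value u
  calc |y - round u * (2 * Real.pi)| = 2 * Real.pi * |u - round u| := by
        rw [hy, mul_comm (round u : ℝ), ← mul_sub, abs_mul, abs_of_pos hp]
    _ ≤ 2 * Real.pi * |u| :=
        mul_le_mul_of_nonneg_left (by simpa using round_le u 0) hp.le
    _ = |y| := by rw [hy, abs_mul, abs_of_pos hp]

theorem exists_coe_eq_abs_eq_norm (a : Real.Angle) : ∃ y : ℝ, (y : Real.Angle) = a ∧ |y| = ‖a‖ := by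
  refine ⟨a.toReal, a.coe_toReal, ?_⟩
  have hp : 0 < 2 * Real.pi := Real.two_pi_pos
  have h := (AddCircle.norm_coe_eq_abs_iff (2 * Real.pi) (x := a.toReal) hp.ne').mpr (by
    rw [abs_of_pos hp]
    linarith [a.abs_toReal_le_pi])
  rw [← h]
  exact congrArg norm a.coe_toReal

/-- A point of the torus at distance less than `D` from `[exp(ix)]` is, up to a rotation, the
exponential of `x + y` with `‖y‖_∞ < D`. -/
theorem exists_lift_of_distToClass_lt {θ : Torus n} {x : onePerp n} {D : ℝ}
    (h : distToClass θ (toPhase x) < D) : ∃ (s : Real.Angle) (y : Fin n → ℝ),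
    (∀ i, |y i| < D) ∧ θ = rot s (expTorus ((x : Fin n → ℝ) + y)) := by
  have hne : {θ' | phaseClass θ' = toPhase x}.Nonempty := ⟨expTorus (x : Fin n → ℝ), rfl⟩
  obtain ⟨θ', hθ', hD⟩ := (Metric.infDist_lt_iff hne).mp h
  obtain ⟨s, rfl⟩ := phaseClass_eq_iff.mp (Eq.symm hθ')
  choose y hy hy' using fun i => exists_coe_eq_abs_eq_norm (θ i - rot s (expTorus x) i)
  refine ⟨s, y, fun i => ?_, ?_⟩
  · rw [hy', ← dist_eq_norm]
    exact (dist_le_pi_dist _ _ i).trans_lt hD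
  · funext i
    have := hy i
    simp only [rot, expTorus, Pi.add_apply, Real.Angle.coe_add] at this ⊢
    rw [this]
    abel

theorem distToClass_rot_expTorus_add_le (s : Real.Angle) (x : onePerp n) {z : Fin n → ℝ} {D : ℝ}
    (hD : 0 ≤ D) (hz : ∀ i, |z i| ≤ D) :
    distToClass (rot s (expTorus ((x : Fin n → ℝ) + z))) (toPhase x) ≤ D := by
  have hmem : rot s (expTorus (x : Fin n → ℝ)) ∈ {θ' | phaseClass θ' = toPhase x} :=
    (phaseClass_eq_iff.mpr ⟨s, rfl⟩).symm
  refine (Metric.infDist_le_dist_of_mem hmem).trans ((dist_pi_le_iff hD).mpr fun i => ?_)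
  have : rot s (expTorus ((x : Fin n → ℝ) + z)) i - rot s (expTorus (x : Fin n → ℝ)) i =
      (z i : Real.Angle) := by
    simp only [rot, expTorus, Pi.add_apply, Real.Angle.coe_add]
    abel
  rw [dist_eq_norm, this]
  exact (norm_coe_angle_le _).trans (hz i)

/-- A synchronization manifold in `B^G(γ)` is exponentially stable: the decay of the displacement
in `1ₙ^⊥` is transported to `𝕋ⁿ/rot` through lifts of the initial phase difference. -/
theorem isLocallyExpStable_toPhase (hG : G.graph.Connected) {γ : ℝ}
    (hγ : γ ∈ Set.Ico 0 (Real.pi / 2)) {x : onePerp n} (hx : x ∈ cohesiveBall O γ)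
    (hsync : NodalBalance O ω x) : IsLocallyExpStable O ω (toPhase x) := by
  have hn : 0 < (n : ℝ) := by
    obtain ⟨i⟩ := hG.nonempty
    have := i.pos
    positivity
  obtain ⟨η, hη, hγη⟩ := exists_between (sub_pos.mpr hγ.2)
  obtain ⟨r, hr, hdiss⟩ := exists_dissipation O hG hη.le hγ.1 (by linarith)
  -- If `‖y‖_∞ < δ`, then `|y|² < n δ²` for the Euclidean norm, hence `‖Bᵀy‖_∞ < 2 √n δ = η`;
  -- the factor `√n` is the price of passing between the two norms.
  refine ⟨η / (2 * √n), by positivity, √n, by positivity, r / 2, by positivity, ?_⟩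
  rintro θ ⟨p, hp⟩ hδ t ht
  -- As the initial distance need not be attained, the bound is proved for every larger `D`.
  have key : ∀ D, distToClass (θ 0) (toPhase x) < D → D < η / (2 * √n) →
      distToClass (θ t) (toPhase x) ≤ √n * Real.exp (-(r / 2) * t) * D := by
    intro D hD hDδ
    have hDpos : 0 < D := lt_of_le_of_lt Metric.infDist_nonneg hD
    obtain ⟨s, y, hy, hθ0⟩ := exists_lift_of_distToClass_lt hD
    -- Removing the mean `μ` of `y`, conserved by the flow, puts the displacement in `1ₙ^⊥`.
    set μ : ℝ := (∑ i, y i) / n with hμ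
    set z : ℝ → Fin n → ℝ := fun t i => p t i - p 0 i + y i - μ with hz
    have hθ : ∀ u, 0 ≤ u → θ u = rot (s + (μ : Real.Angle)) (expTorus ((x : Fin n → ℝ) + z u)) := by
      intro u hu
      funext i
      have h0 := congrFun hθ0 i
      rw [(hp 0 le_rfl).1] at h0
      rw [(hp u hu).1]
      simp only [rot, expTorus, Pi.add_apply, hz, Real.Angle.coe_add, Real.Angle.coe_sub] at h0 ⊢
      rw [h0]
      abel
    have hder : ∀ u, 0 ≤ u → HasDerivWithinAt z (-(incidence O *ᵥ (weightMatrix O *ᵥ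
        (sinIncidence O (x + z u) - sinIncidence O x)))) (Set.Ici 0) u := by
      intro u hu
      have hF : vectorField O ω (θ u) = -(incidence O *ᵥ (weightMatrix O *ᵥ
          (sinIncidence O (x + z u) - sinIncidence O x))) := by
        rw [vectorField, hθ u hu, sinDiff_rot, sinDiff_expTorus, Matrix.mulVec_sub,
          Matrix.mulVec_sub, ← hsync, neg_sub]
      rw [← hF]
      refine hasDerivWithinAt_pi.mpr fun i => ?_
      exact (((hasDerivWithinAt_pi.mp (hp u hu).2 i).sub_const _).add_const _).sub_const _
    have hz0 : ∀ i, z 0 i = y i - μ := fun i => by simp [hz]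
    have hmem : z 0 ∈ onePerp n := by
      change ∑ i, z 0 i = 0
      simp only [hz0, Finset.sum_sub_distrib]
      simp only [Finset.sum_const, Finset.card_univ, Fintype.card_fin, nsmul_eq_mul, hμ]
      field_simp
      ring
    have hV0 : ∑ i, z 0 i ^ 2 ≤ n * D ^ 2 := by
      -- Subtracting the mean decreases the sum of squares.
      have h1 : ∑ i, z 0 i ^ 2 + n * μ ^ 2 = ∑ i, y i ^ 2 := by
        have hs : ∑ i, y i = n * μ := by rw [hμ]; field_simp
        simp only [hz0, sub_sq, Finset.sum_add_distrib, Finset.sum_sub_distrib,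
          ← Finset.sum_mul, ← Finset.mul_sum, hs]
        simp
        ring
      have h2 : ∑ i, y i ^ 2 ≤ n * D ^ 2 := by
        have := Finset.sum_le_sum fun i (_ : i ∈ Finset.univ) =>
          sq_le_sq' (abs_lt.mp (hy i)).1.le (abs_lt.mp (hy i)).2.le
        simpa using this
      nlinarith [sq_nonneg μ]
    have hsqrt : √(n * D ^ 2) = √n * D := by
      rw [Real.sqrt_mul hn.le, Real.sqrt_sq hDpos.le]
    have hdecay := sum_sq_le_exp_of_dissipation O (C := n * D ^ 2) hr (by positivity)
      (by
        rw [hsqrt, ← mul_assoc, mul_comm]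
        exact (le_div_iff₀ (by positivity)).mp hDδ.le)
      (hdiss x hx) hmem hV0 hder ht
    rw [hθ t ht]
    refine distToClass_rot_expTorus_add_le _ x (by positivity) fun i => ?_
    have hi : z t i ^ 2 ≤ ∑ i, z t i ^ 2 :=
      Finset.single_le_sum (f := fun i => z t i ^ 2) (fun i _ => sq_nonneg _) (Finset.mem_univ i)
    refine abs_le_of_sq_le_sq ((hi.trans hdecay).trans_eq ?_) (by positivity)
    rw [mul_pow, mul_pow, Real.sq_sqrt hn.le, ← Real.exp_nat_mul]
    push_cast
    ring_nf
  have hk : 0 < √n * Real.exp (-(r / 2) * t) := by positivity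
  by_contra! hlt
  rw [mul_comm, ← lt_div_iff₀ hk] at hlt
  obtain ⟨D, hD1, hD2⟩ := exists_between (lt_min hδ hlt)
  have h := key D hD1 (hD2.trans_le (min_le_left _ _))
  have h' := (lt_div_iff₀ hk).mp (hD2.trans_le (min_le_right _ _))
  linarith [mul_comm D (√n * Real.exp (-(r / 2) * t))]

end Stability

end Kuramoto

end

theorem mainTheorem6 {n m : ℕ} (G : Kuramoto.WeightedGraph n) (hG : G.graph.Connected)
    (O : Kuramoto.Orientation G m) (ω : Fin n → ℝ) (hω : ω ∈ Kuramoto.onePerp n)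
    (γ : ℝ) (hγ : γ ∈ Set.Ico 0 (Real.pi / 2)) :
    (∀ x : Kuramoto.onePerp n,
      (Kuramoto.IsSyncManifold O ω (Kuramoto.toPhase x) ↔ Kuramoto.NodalBalance O ω x) ∧
      (Kuramoto.NodalBalance O ω x ↔ Kuramoto.EdgeBalance O ω x)) ∧
    (AnalyticOnNhd ℝ (Kuramoto.kuramotoMap O) Set.univ ∧
      Set.InjOn (Kuramoto.kuramotoMap O) (Kuramoto.cohesiveBall O γ)) ∧
    (∀ x ∈ Kuramoto.cohesiveBall O γ, Kuramoto.IsSyncManifold O ω (Kuramoto.toPhase x) →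
      (∀ y ∈ Kuramoto.cohesiveBall O γ,
        Kuramoto.IsSyncManifold O ω (Kuramoto.toPhase y) → y = x) ∧
      (∀ Θ ∈ Kuramoto.embeddedCohesive O γ,
        Kuramoto.IsSyncManifold O ω Θ → Θ = Kuramoto.toPhase x) ∧
      Kuramoto.IsLocallyExpStable O ω (Kuramoto.toPhase x)) := by
  have hsync : ∀ x : Kuramoto.onePerp n,
      Kuramoto.IsSyncManifold O ω (Kuramoto.toPhase x) ↔ Kuramoto.NodalBalance O ω x :=
    Kuramoto.isSyncManifold_toPhase_iff O ω
  have hedge : ∀ x : Kuramoto.onePerp n,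
      Kuramoto.NodalBalance O ω x ↔ Kuramoto.EdgeBalance O ω x :=
    Kuramoto.nodalBalance_iff_edgeBalance O ω hG hω
  have hinj := Kuramoto.injOn_kuramotoMap O hG hγ.2
  refine ⟨fun x => ⟨hsync x, hedge x⟩, ⟨Kuramoto.analyticOnNhd_kuramotoMap O, hinj⟩, ?_⟩
  intro x hx hxs
  have huniq : ∀ y ∈ Kuramoto.cohesiveBall O γ,
      Kuramoto.IsSyncManifold O ω (Kuramoto.toPhase y) → y = x := by
    intro y hy hys
    have hx' : Kuramoto.EdgeBalance O ω x := (hedge x).mp ((hsync x).mp hxs)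
    have hy' : Kuramoto.EdgeBalance O ω y := (hedge y).mp ((hsync y).mp hys)
    exact hinj hy hx (Subtype.ext (hy'.symm.trans hx'))
  refine ⟨huniq, ?_, Kuramoto.isLocallyExpStable_toPhase O ω hG hγ hx ((hsync x).mp hxs)⟩
  rintro _ ⟨y, hy, rfl⟩ hys
  rw [huniq y hy hys]
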